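/- Let $n_1,n_2,k,N$ be integers with $1\le k\le\min\{n_1,n_2\}$, let $B_1,\dots,B_N\in\mathbb{C}^{n_1\times n_2}$, and let $\tau=(k_1,\dots,k_t)$ with integers $k_i\ge 1$ and $k_1+\dots+k_t=k$. For $A\in\mathbb{C}^{k\times k}$, partitioned into blocks $A_{ij}\in\mathbb{C}^{k_i\times k_j}$, let $\mathrm{BDiag}_\tau(A)=\mathrm{diag}(A_{11},\dots,A_{tt})$. Let $\mathrm{St}(k,n)=\{P\in\mathbb{C}^{n\times k}: P^{H}P=I_k\}$. For $U=[U_1,\dots,U_t]\in\mathbb{C}^{n_1\times k}$ and $V=[V_1,\dots,V_t]\in\mathbb{C}^{n_2\times k}$, with $U_i$ and $V_i$ having $k_i$ columns, put $$f(U,V)=\sum_{\ell=1}^N\big\|\mathrm{BDiag}_\tau(U^{H}B_\ell V)\big\|_F^2$$ and let $H_1=\nabla_U f$, $H_2=\nabla_V f$ be its partial Euclidean gradients with respect to $\langle X,Y\rangle=\mathrm{Re}\,\mathrm{tr}(Y^{H}X)$, that is, $$H_1(U,V)=2\sum_{\ell=1}^N\big[B_\ell V_1(V_1^{H}B_\ell^{H}U_1),\dots,B_\ell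 V_t(V_t^{H}B_\ell^{H}U_t)\big],\qquad H_2(U,V)=2\sum_{\ell=1}^N\big[B_\ell^{H}U_1(U_1^{H}B_\ell V_1),\dots,B_\ell^{H}U_t(U_t^{H}B_\ell V_t)\big].$$ An orthonormal polar factor of $H\in\mathbb{C}^{n\times k}$ is a $W\in\mathrm{St}(k,n)$ such that $H=W\Lambda$ for some Hermitian $\Lambda\succeq 0$ (it need not be unique if $\mathrm{rank}\,H<k$). Let $(U^{(j)},V^{(j)})_{j\ge 0}$ be generated by the alternating iteration with Gauss-Seidel updating: $(U^{(0)},V^{(0)})\in\mathrm{St}(k,n_1)\times\mathrm{St}(k,n_2)$ and, for all $j\ge0$, $U^{(j+1)}$ is an orthonormal polar factor of $H_1^{(j)}:=H_1(U^{(j)},V^{(j)})$ and $V^{(j+1)}$ is an orthonormal polar factor of $\widehat H_2^{(j)}:=H_2(U^{(j+1)},V^{(j)})$. Then the following hold. (a) The sequence $f(U^{(j)},V^{(j)})$ is monotonically increasing (non-decreasing) and convergent. (b) Let $(U_*,V_*)$ be an accumulation point of $(U^{(j)},V^{(j)})_{j\ge0}$ and let $(U^{(j)},V^{(j)})_{j\in\mathbb{I}}$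 be a subsequence converging to it. Then $U_*\in\mathrm{St}(k,n_1)$, $V_*\in\mathrm{St}(k,n_2)$, the sequence $(U^{(j+1)})_{j\in\mathbb{I}}$ has an accumulation point, and for every accumulation point $\widehat U_*$ of $(U^{(j+1)})_{j\in\mathbb{I}}$, $$H_1(U_*,V_*)=U_*\Lambda_{1*},\quad \Lambda_{1*}=U_*^{H}H_1(U_*,V_*)\succeq0,\qquad H_2(\widehat U_*,V_*)=V_*\Lambda_{2*},\quad \Lambda_{2*}=V_*^{H}H_2(\widehat U_*,V_*)\succeq0.$$ As a result, if $\widehat U_*=U_*$, then $$H_1(U_*,V_*)=U_*\Lambda_{1*},\quad \Lambda_{1*}=U_*^{H}H_1(U_*,V_*)\succeq0,\qquad H_2(U_*,V_*)=V_*\Lambda_{2*},\quad \Lambda_{2*}=V_*^{H}H_2(U_*,V_*)\succeq0.\tag{1}$$ (c) In (b), if $\mathrm{rank}\,H_1(U_*,V_*)=k$, then $\widehat U_*=U_*$ for every such $\widehat U_*$, and hence (1) holds. (d) If $(U_*,V_*)$ is an isolated accumulation point of $(U^{(j)},V^{(j)})_{j\ge0}$ (some neighbourhood of it contains no other accumulation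 point of the sequence) and $\mathrm{rank}\,H_1(U_*,V_*)=\mathrm{rank}\,H_2(U_*,V_*)=k$, then the entire sequence $(U^{(j)},V^{(j)})$ converges to $(U_*,V_*)$. (e) Let $\sigma_{\min}(X)$ be the smallest of the $\min\{m,n\}$ singular values of $X\in\mathbb{C}^{m\times n}$, $\mathcal{R}(X)$ its column space, and $\Theta(\cdot,\cdot)$ the diagonal matrix of the canonical angles between two subspaces of equal dimension (the arccosines of the singular values of $X^{H}Y$ for matrices $X,Y$ whose columns are orthonormal bases of the two subspaces). Then the following four series converge: $$\sum_{j=0}^\infty\sigma_{\min}(H_1^{(j)})\,\big\|\sin\Theta\big(\mathcal{R}(U^{(j+1)}),\mathcal{R}(U^{(j)})\big)\big\|_F^2,\qquad \sum_{j=0}^\infty\sigma_{\min}(\widehat H_2^{(j)})\,\big\|\sin\Theta\big(\mathcal{R}(V^{(j+1)}),\mathcal{R}(V^{(j)})\big)\big\|_F^2,$$ $$\sum_{j=0}^\infty\sigma_{\min}(H_1^{(j)})\,\frac{\big\|H_1^{(j)}-U^{(j)}\big([U^{(j)}]^{H}H_1^{(j)}\big)\big\|_F^2}{\big\|H_1^{(j)}\big\|_F^2},\qquad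 \sum_{j=0}^\infty\sigma_{\min}(\widehat H_2^{(j)})\,\frac{\big\|\widehat H_2^{(j)}-V^{(j)}\big([V^{(j)}]^{H}\widehat H_2^{(j)}\big)\big\|_F^2}{\big\|\widehat H_2^{(j)}\big\|_F^2},$$ where a term of the last two series is read as $0$ if its denominator vanishes. -/

import Mathlib

open Filter Topology Matrix
open scoped ComplexOrder

noncomputable section

namespace JointSVD

/-- The Frobenius norm of a complex matrix. -/
def frobNorm {m n : ℕ} (A : Matrix (Fin m) (Fin n) ℂ) : ℝ :=
  Real.sqrt (∑ i, ∑ j, ‖A i j‖ ^ 2)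

/-- The complex Stiefel manifold of `n × k` matrices with orthonormal columns. -/
def stiefel (n k : ℕ) : Set (Matrix (Fin n) (Fin k) ℂ) :=
  {P | Pᴴ * P = 1}

/-- The block diagonal part of a `k × k` matrix with respect to `τ = (k₁, …, k_t)`, a list of
positive integers with sum `k`; `τ.index p` is the number of the block that contains `p`. -/
def blockDiagPart {k : ℕ} (τ : Composition k) (A : Matrix (Fin k) (Fin k) ℂ) :
    Matrix (Fin k) (Fin k) ℂ :=
  Matrix.of fun p q => if τ.index p = τ.index q then A p q else 0

section Objective

variable {n₁ n₂ k N : ℕ} (τ : Composition k) (B : Fin N → Matrix (Fin n₁) (Fin n₂) ℂ)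

/-- The objective function `f(U, V)`. -/
def objective (U : Matrix (Fin n₁) (Fin k) ℂ) (V : Matrix (Fin n₂) (Fin k) ℂ) : ℝ :=
  ∑ l, frobNorm (blockDiagPart τ (Uᴴ * B l * V)) ^ 2

/-- The partial gradient of `f` with respect to `U`. The block of columns number `i` of
`B V blockDiagPart (Vᴴ Bᴴ U)` is `B Vᵢ (Vᵢᴴ Bᴴ Uᵢ)`. -/
def gradU (U : Matrix (Fin n₁) (Fin k) ℂ) (V : Matrix (Fin n₂) (Fin k) ℂ) :
    Matrix (Fin n₁) (Fin k) ℂ :=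
  (2 : ℂ) • ∑ l, B l * V * blockDiagPart τ (Vᴴ * (B l)ᴴ * U)

/-- The partial gradient of `f` with respect to `V`. The block of columns number `i` of
`Bᴴ U blockDiagPart (Uᴴ B V)` is `Bᴴ Uᵢ (Uᵢᴴ B Vᵢ)`. -/
def gradV (U : Matrix (Fin n₁) (Fin k) ℂ) (V : Matrix (Fin n₂) (Fin k) ℂ) :
    Matrix (Fin n₂) (Fin k) ℂ :=
  (2 : ℂ) • ∑ l, (B l)ᴴ * U * blockDiagPart τ (Uᴴ * B l * V)

end Objective

/-- `G` is the Euclidean gradient of `g` at `P` for the inner product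
`⟨X, Y⟩ = Re tr (Yᴴ X)` on complex matrices. -/
def IsEuclideanGradient {n k : ℕ} (g : Matrix (Fin n) (Fin k) ℂ → ℝ)
    (P G : Matrix (Fin n) (Fin k) ℂ) : Prop :=
  (fun E => g (P + E) - g P - (trace (Eᴴ * G)).re) =o[𝓝 0] fun E => frobNorm E

lemma frobNorm_sq {m n : ℕ} (A : Matrix (Fin m) (Fin n) ℂ) :
    frobNorm A ^ 2 = ∑ i, ∑ j, ‖A i j‖ ^ 2 :=
  Real.sq_sqrt (by positivity)

lemma frobNorm_mul_sq_le {m n p : ℕ} (A : Matrix (Fin m) (Fin n) ℂ)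
    (C : Matrix (Fin n) (Fin p) ℂ) :
    frobNorm (A * C) ^ 2 ≤ frobNorm A ^ 2 * frobNorm C ^ 2 := by
  rw [frobNorm_sq, frobNorm_sq, frobNorm_sq, Finset.sum_mul]
  refine Finset.sum_le_sum fun i _ => ?_
  rw [Finset.sum_comm (s := Finset.univ (α := Fin n)), Finset.mul_sum]
  refine Finset.sum_le_sum fun j _ => ?_
  have h1 : ‖(A * C) i j‖ ≤ ∑ x, ‖A i x‖ * ‖C x j‖ := by
    rw [Matrix.mul_apply]
    exact (norm_sum_le _ _).trans (by simp)
  exact (pow_le_pow_left₀ (norm_nonneg _) h1 2).trans (Finset.sum_mul_sq_le_sq_mul_sq _ _ _)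

lemma frobNorm_blockDiagPart_sq_le {k : ℕ} (τ : Composition k) (A : Matrix (Fin k) (Fin k) ℂ) :
    frobNorm (blockDiagPart τ A) ^ 2 ≤ frobNorm A ^ 2 := by
  rw [frobNorm_sq, frobNorm_sq]
  refine Finset.sum_le_sum fun i _ => Finset.sum_le_sum fun j _ => ?_
  by_cases h : τ.index i = τ.index j
  · simp [blockDiagPart, h]
  · simp [blockDiagPart, h]

lemma frobNorm_conjTranspose {m n : ℕ} (A : Matrix (Fin m) (Fin n) ℂ) :
    frobNorm Aᴴ = frobNorm A := by
  unfold frobNorm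
  rw [Finset.sum_comm]
  simp

lemma blockDiagPart_conjTranspose {k : ℕ} (τ : Composition k) (A : Matrix (Fin k) (Fin k) ℂ) :
    blockDiagPart τ Aᴴ = (blockDiagPart τ A)ᴴ := by
  ext i j
  by_cases h : τ.index i = τ.index j
  · simp [blockDiagPart, h]
  · simp [blockDiagPart, h, Ne.symm h]

lemma frobNorm_blockDiagPart_add {k : ℕ} (τ : Composition k) (X Y : Matrix (Fin k) (Fin k) ℂ) :
    frobNorm (blockDiagPart τ (X + Y)) ^ 2 = frobNorm (blockDiagPart τ X) ^ 2 +
      2 * (trace (Y * blockDiagPart τ Xᴴ)).re + frobNorm (blockDiagPart τ Y) ^ 2 := by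
  simp only [frobNorm_sq, trace, diag_apply, Matrix.mul_apply, Complex.re_sum, Finset.mul_sum,
    ← Finset.sum_add_distrib]
  refine Finset.sum_congr rfl fun i _ => Finset.sum_congr rfl fun j _ => ?_
  by_cases h : τ.index i = τ.index j
  · simp only [blockDiagPart, Matrix.of_apply, h, if_true, Matrix.add_apply,
      conjTranspose_apply, Complex.sq_norm, Complex.normSq_apply]
    simp
    ring
  · simp [blockDiagPart, h, Ne.symm h]

lemma objective_add_left {n₁ n₂ k N : ℕ} (τ : Composition k)
    (B : Fin N → Matrix (Fin n₁) (Fin n₂) ℂ)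
    (U E : Matrix (Fin n₁) (Fin k) ℂ) (V : Matrix (Fin n₂) (Fin k) ℂ) :
    objective τ B (U + E) V =
      objective τ B U V + (trace (Eᴴ * gradU τ B U V)).re + objective τ B E V := by
  have h : (trace (Eᴴ * gradU τ B U V)).re =
      ∑ l, 2 * (trace (Eᴴ * B l * V * blockDiagPart τ (Uᴴ * B l * V)ᴴ)).re := by
    simp only [gradU, Matrix.mul_smul, Matrix.mul_sum, trace_smul, trace_sum, smul_eq_mul,
      Finset.mul_sum, Complex.re_sum]
    simp [Matrix.mul_assoc]
  rw [h]
  simp only [objective, ← Finset.sum_add_distrib]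
  refine Finset.sum_congr rfl fun l _ => ?_
  rw [← frobNorm_blockDiagPart_add]
  simp [Matrix.add_mul]

lemma objective_swap {n₁ n₂ k N : ℕ} (τ : Composition k)
    (B : Fin N → Matrix (Fin n₁) (Fin n₂) ℂ)
    (U : Matrix (Fin n₁) (Fin k) ℂ) (V : Matrix (Fin n₂) (Fin k) ℂ) :
    objective τ B U V = objective τ (fun l => (B l)ᴴ) V U := by
  unfold objective
  refine Finset.sum_congr rfl fun l _ => ?_
  rw [← frobNorm_conjTranspose, ← blockDiagPart_conjTranspose]
  simp [Matrix.mul_assoc]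

/-- `gradU` is the Euclidean gradient of the objective with respect to `U`. -/
theorem isEuclideanGradient_gradU {n₁ n₂ k N : ℕ} (τ : Composition k)
    (B : Fin N → Matrix (Fin n₁) (Fin n₂) ℂ)
    (U : Matrix (Fin n₁) (Fin k) ℂ) (V : Matrix (Fin n₂) (Fin k) ℂ) :
    IsEuclideanGradient (fun U' => objective τ B U' V) U (gradU τ B U V) := by
  have hcont : Tendsto (fun E : Matrix (Fin n₁) (Fin k) ℂ => frobNorm E) (𝓝 0) (𝓝 0) := by
    have : Continuous (fun E : Matrix (Fin n₁) (Fin k) ℂ => frobNorm E) := by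
      unfold frobNorm
      fun_prop
    simpa [frobNorm] using this.tendsto 0
  have hlo : (fun E : Matrix (Fin n₁) (Fin k) ℂ => frobNorm E ^ 2) =o[𝓝 0]
      fun E => frobNorm E := by
    simpa [pow_two] using ((Asymptotics.isLittleO_one_iff ℝ).2 hcont).mul_isBigO
      (Asymptotics.isBigO_refl (fun E : Matrix (Fin n₁) (Fin k) ℂ => frobNorm E) (𝓝 0))
  refine Asymptotics.IsBigO.trans_isLittleO ?_ hlo
  refine Asymptotics.IsBigO.of_bound (∑ l, frobNorm (B l * V) ^ 2) (Eventually.of_forall fun E => ?_)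
  have h0 : 0 ≤ objective τ B E V := Finset.sum_nonneg fun _ _ => sq_nonneg _
  beta_reduce
  rw [objective_add_left, show ∀ a b c : ℝ, a + b + c - a - b = c by intros; ring,
    Real.norm_of_nonneg h0, Real.norm_of_nonneg (sq_nonneg _), objective, Finset.sum_mul]
  refine Finset.sum_le_sum fun l _ => (frobNorm_blockDiagPart_sq_le _ _).trans ?_
  rw [Matrix.mul_assoc, mul_comm, ← frobNorm_conjTranspose E]
  exact frobNorm_mul_sq_le _ _

/-- `gradV` is the Euclidean gradient of the objective with respect to `V`. -/
theorem isEuclideanGradient_gradV {n₁ n₂ k N : ℕ} (τ : Composition k)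
    (B : Fin N → Matrix (Fin n₁) (Fin n₂) ℂ)
    (U : Matrix (Fin n₁) (Fin k) ℂ) (V : Matrix (Fin n₂) (Fin k) ℂ) :
    IsEuclideanGradient (fun V' => objective τ B U V') V (gradV τ B U V) := by
  have h := isEuclideanGradient_gradU τ (fun l => (B l)ᴴ) V U
  have hg : gradU τ (fun l => (B l)ᴴ) V U = gradV τ B U V := by
    simp [gradU, gradV]
  rw [hg] at h
  simpa only [← objective_swap] using h

/-- `W` is an orthonormal polar factor of `H`: it has orthonormal columns and `H = W Λ` for a
positive semidefinite `Λ`. It is unique if `H` has full column rank, and otherwise not. -/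
def IsOrthonormalPolarFactor {n k : ℕ} (W H : Matrix (Fin n) (Fin k) ℂ) : Prop :=
  W ∈ stiefel n k ∧ ∃ Λ : Matrix (Fin k) (Fin k) ℂ, Λ.PosSemidef ∧ H = W * Λ

/-- The sequence `(U j, V j)` is generated by the alternating SCF iteration with
Gauss-Seidel-type updating; any orthonormal polar factor may be taken at each step. -/
structure IsGaussSeidelASCF {n₁ n₂ k N : ℕ} (τ : Composition k)
    (B : Fin N → Matrix (Fin n₁) (Fin n₂) ℂ)
    (U : ℕ → Matrix (Fin n₁) (Fin k) ℂ) (V : ℕ → Matrix (Fin n₂) (Fin k) ℂ) : Prop where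
  init_U : U 0 ∈ stiefel n₁ k
  init_V : V 0 ∈ stiefel n₂ k
  step_U : ∀ j, IsOrthonormalPolarFactor (U (j + 1)) (gradU τ B (U j) (V j))
  step_V : ∀ j, IsOrthonormalPolarFactor (V (j + 1)) (gradV τ B (U (j + 1)) (V j))

/-- The polar-decomposition condition `H = W Λ` with `W` orthonormal and `Λ = Wᴴ H ⪰ 0`. -/
def PolarKKT {n k : ℕ} (W H : Matrix (Fin n) (Fin k) ℂ) : Prop :=
  W ∈ stiefel n k ∧ H = W * (Wᴴ * H) ∧ (Wᴴ * H).PosSemidef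

/-- The smallest of the `min m n` singular values of an `m × n` matrix
(Mathlib numbers the singular values from `0` in decreasing order). -/
def sigmaMin {m n : ℕ} (X : Matrix (Fin m) (Fin n) ℂ) : ℝ :=
  (Matrix.toEuclideanLin X).singularValues (min m n - 1)

/-- The column space of a matrix. -/
def colSpace {m n : ℕ} (X : Matrix (Fin m) (Fin n) ℂ) : Submodule ℂ (EuclideanSpace ℂ (Fin m)) :=
  LinearMap.range (Matrix.toEuclideanLin X)

/-- The canonical angles between two subspaces of equal dimension `d`: the arccosines of the `d`
singular values of the orthogonal projection onto `S`, restricted to `T`. In orthonormal bases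
`X` of `S` and `Y` of `T` this is the map with matrix `Xᴴ Y`. -/
def canonicalAngle {n : ℕ} (S T : Submodule ℂ (EuclideanSpace ℂ (Fin n))) (i : ℕ) : ℝ :=
  Real.arccos
    (LinearMap.singularValues (𝕜 := ℂ) (E := T) (F := S)
      (S.orthogonalProjectionOnto.toLinearMap ∘ₗ T.subtype) i)

/-- `‖sin Θ(S, T)‖_F` for the diagonal matrix `Θ(S, T)` of the canonical angles. -/
def sinThetaNorm {n : ℕ} (S T : Submodule ℂ (EuclideanSpace ℂ (Fin n))) : ℝ :=
  Real.sqrt (∑ i ∈ Finset.range (Module.finrank ℂ T), Real.sin (canonicalAngle S T i) ^ 2)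

/-- `p` is an isolated accumulation point of the sequence `s`. -/
def IsIsolatedAccPt {X : Type*} [TopologicalSpace X] (s : ℕ → X) (p : X) : Prop :=
  MapClusterPt p atTop s ∧ ∀ᶠ q in 𝓝[≠] p, ¬ MapClusterPt q atTop s

end JointSVD

end

/-! For fixed `V` the objective is a nonnegative quadratic form in `U`, hence convex: moving from
`U` to `W` raises it by at least the linear gain `Re tr ((W - U)ᴴ H)`, where `H` is the gradient at
`U`. Exchanging `U` with `V` and each `B l` with its adjoint gives the same for `V`. If `W` is a
polar factor, `H = W Λ`, then twice the gain is `tr ((W - U) Λ (W - U)ᴴ) ≥ 0`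
(`two_mul_re_trace_polar`). So the objective increases; it is bounded on the Stiefel manifolds,
hence the gains are summable.

The rest is read off from the gains. In a limit the gain vanishes, which forces `(W - U) Λ = 0`: the
old iterate is itself a polar factor, and equals the new one if `Λ` is invertible
(`polarKKT_of_re_trace_eq_zero`). For the series, `Λ ⪰ σ_min(H) I` bounds `σ_min(H) ‖W - U‖_F²` by
twice the gain, and `‖W - U‖_F` dominates both the sines of the angles and the relative residual.
Near an isolated accumulation point with full-rank gradients the steps become stationary, so the
sequence cannot escape (`tendsto_of_isIsolatedAccPt`). -/

namespace JointSVD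

/-! ### Frobenius norm, polar factors and the smallest singular value. -/

section Matrices

variable {m n k : ℕ}

lemma frobNorm_sq_eq_re_trace (A : Matrix (Fin m) (Fin n) ℂ) :
    frobNorm A ^ 2 = (trace (Aᴴ * A)).re := by
  rw [frobNorm_sq, Finset.sum_comm]
  simp [trace, Matrix.mul_apply, Complex.sq_norm, Complex.normSq_apply]

lemma frobNorm_sq_of_mem_stiefel {U : Matrix (Fin n) (Fin k) ℂ} (hU : U ∈ stiefel n k) :
    frobNorm U ^ 2 = k := by
  rw [frobNorm_sq_eq_re_trace, show Uᴴ * U = 1 from hU]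
  simp

/-- Left multiplication by a matrix with orthonormal columns preserves the Frobenius norm. -/
lemma frobNorm_mul_of_mem_stiefel {U : Matrix (Fin n) (Fin k) ℂ} (hU : U ∈ stiefel n k)
    (A : Matrix (Fin k) (Fin m) ℂ) : frobNorm (U * A) ^ 2 = frobNorm A ^ 2 := by
  rw [frobNorm_sq_eq_re_trace, frobNorm_sq_eq_re_trace, conjTranspose_mul, Matrix.mul_assoc,
    ← Matrix.mul_assoc Uᴴ, show Uᴴ * U = 1 from hU, Matrix.one_mul]

/-- Removing the component in the column space of `U` does not increase the Frobenius norm. -/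
lemma frobNorm_sub_proj_le {U : Matrix (Fin n) (Fin k) ℂ} (hU : U ∈ stiefel n k)
    (E : Matrix (Fin n) (Fin m) ℂ) : frobNorm (E - U * (Uᴴ * E)) ^ 2 ≤ frobNorm E ^ 2 := by
  have hU' : Uᴴ * U = 1 := hU
  have h : (E - U * (Uᴴ * E))ᴴ * (E - U * (Uᴴ * E)) = Eᴴ * E - (Uᴴ * E)ᴴ * (Uᴴ * E) := by
    have : Eᴴ * U * (Uᴴ * U) * Uᴴ * E = Eᴴ * U * Uᴴ * E := by rw [hU', Matrix.mul_one]
    simp only [conjTranspose_sub, conjTranspose_mul, conjTranspose_conjTranspose, Matrix.sub_mul,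
      Matrix.mul_sub]
    simp only [← Matrix.mul_assoc] at this ⊢
    rw [this]
    abel
  rw [frobNorm_sq_eq_re_trace, h, trace_sub, Complex.sub_re, ← frobNorm_sq_eq_re_trace,
    ← frobNorm_sq_eq_re_trace]
  linarith [sq_nonneg (frobNorm (Uᴴ * E))]

-- With `Λ = Cᴴ C` the trace is the squared Frobenius norm of `C Xᴴ`, so `X Cᴴ = 0` and `X Λ = X Cᴴ
-- C = 0`.
open scoped MatrixOrder in
lemma mul_eq_zero_of_re_trace_eq_zero {Λ : Matrix (Fin k) (Fin k) ℂ} (hΛ : Λ.PosSemidef)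
    (X : Matrix (Fin n) (Fin k) ℂ) (h : (trace (X * Λ * Xᴴ)).re = 0) : X * Λ = 0 := by
  obtain ⟨C, rfl⟩ := (CStarAlgebra.nonneg_iff_eq_star_mul_self (a := Λ)).mp hΛ.nonneg
  rw [star_eq_conjTranspose] at h ⊢
  have h0 : trace ((C * Xᴴ)ᴴ * (C * Xᴴ)) = 0 := by
    have hpos := (posSemidef_conjTranspose_mul_self (C * Xᴴ)).trace_nonneg
    refine Complex.ext ?_ (Complex.le_def.mp hpos).2.symm
    simpa [Matrix.mul_assoc] using h
  have h1 := trace_conjTranspose_mul_self_eq_zero_iff.mp h0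
  have h2 : X * Cᴴ = 0 := by simpa using congrArg conjTranspose h1
  rw [← Matrix.mul_assoc, h2, Matrix.zero_mul]

/-- The gain of the linear functional `X ↦ Re tr (Xᴴ H)` between `U` and the polar factor `W` of
`H = W Λ` is half the squared `Λ`-weighted distance of `W` and `U`. -/
lemma two_mul_re_trace_polar {W U : Matrix (Fin n) (Fin k) ℂ} {Λ : Matrix (Fin k) (Fin k) ℂ}
    (hW : W ∈ stiefel n k) (hU : U ∈ stiefel n k) (hΛ : Λ.PosSemidef) :
    2 * (trace ((W - U)ᴴ * (W * Λ))).re = (trace ((W - U) * Λ * (W - U)ᴴ)).re := by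
  have hW' : Wᴴ * W = 1 := hW
  have hU' : Uᴴ * U = 1 := hU
  -- The two cross terms are complex conjugates because `Λ` is Hermitian, so their real parts agree.
  have hs : (trace (Wᴴ * U * Λ)).re = (trace (Uᴴ * W * Λ)).re := by
    have : trace (Wᴴ * U * Λ) = star (trace (Uᴴ * W * Λ)) := by
      rw [← trace_conjTranspose, conjTranspose_mul, conjTranspose_mul, hΛ.isHermitian.eq,
        conjTranspose_conjTranspose, trace_mul_comm]
    rw [this]
    simp
  rw [trace_mul_comm _ (W - U)ᴴ]
  simp only [conjTranspose_sub, Matrix.sub_mul, Matrix.mul_sub, trace_sub, Complex.sub_re,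
    ← Matrix.mul_assoc, hW', hU', hs]
  ring

lemma re_trace_polar_nonneg {W U H : Matrix (Fin n) (Fin k) ℂ}
    (hW : IsOrthonormalPolarFactor W H) (hU : U ∈ stiefel n k) :
    0 ≤ (trace ((W - U)ᴴ * H)).re := by
  obtain ⟨hW, Λ, hΛ, rfl⟩ := hW
  have h := two_mul_re_trace_polar hW hU hΛ
  have h' := (Complex.le_def.mp (hΛ.mul_mul_conjTranspose_same (W - U)).trace_nonneg).1
  simp only [Complex.zero_re] at h'
  linarith

lemma sigmaMin_nonneg (X : Matrix (Fin m) (Fin n) ℂ) : 0 ≤ sigmaMin X :=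
  LinearMap.singularValues_nonneg _ _

/-- Every eigenvalue of `Hᴴ H` is at least `sigmaMin H ^ 2`. -/
lemma sigmaMin_sq_le_of_mulVec_eq {H : Matrix (Fin n) (Fin k) ℂ} (hk : 1 ≤ k) (hkn : k ≤ n)
    {μ : ℝ} {v : EuclideanSpace ℂ (Fin k)} (hv : v ≠ 0)
    (h : (Hᴴ * H) *ᵥ v.ofLp = (μ : ℂ) • v.ofLp) : sigmaMin H ^ 2 ≤ μ := by
  set T := Matrix.toEuclideanLin H with hT
  have hfin : Module.finrank ℂ (EuclideanSpace ℂ (Fin k)) = k := by simp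
  have hev : Module.End.HasEigenvalue (LinearMap.adjoint T ∘ₗ T) (μ : ℂ) := by
    refine Module.End.hasEigenvalue_of_hasEigenvector (x := v) ⟨?_, hv⟩
    rw [Module.End.mem_eigenspace_iff, hT, ← Matrix.toEuclideanLin_conjTranspose_eq_adjoint]
    ext i
    simpa [Matrix.toLpLin_apply, Matrix.mulVec_mulVec] using congrFun h i
  obtain ⟨i, hi⟩ := T.isSymmetric_adjoint_comp_self.exists_eigenvalues_eq hfin hev
  have hi' : T.isSymmetric_adjoint_comp_self.eigenvalues hfin i = μ :=
    Complex.ofReal_injective hi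
  -- Singular values are numbered from `0`, so the smallest has index `k - 1`; the eigenvalues are
  -- sorted decreasingly, so the last one bounds `μ` from below.
  have hlt : k - 1 < k := by omega
  rw [sigmaMin, min_eq_right hkn, T.sq_singularValues_of_lt hfin hlt, ← hi']
  refine T.isSymmetric_adjoint_comp_self.eigenvalues_antitone hfin ?_
  rw [Fin.le_def]
  simp only
  omega

/-- Since `Wᴴ W = 1`, the Gram matrix of `W Λ` is `Λ²`. An eigenvalue `μ` of the difference comes
from the eigenvalue `μ + σ` of `Λ`, whose square is therefore at least `σ²`. -/
lemma posSemidef_sub_sigmaMin {W : Matrix (Fin n) (Fin k) ℂ} {Λ : Matrix (Fin k) (Fin k) ℂ}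
    (hk : 1 ≤ k) (hkn : k ≤ n) (hW : W ∈ stiefel n k) (hΛ : Λ.PosSemidef) :
    (Λ - (sigmaMin (W * Λ) : ℂ) • (1 : Matrix (Fin k) (Fin k) ℂ)).PosSemidef := by
  set σ := sigmaMin (W * Λ) with hσ
  have hherm : (Λ - (σ : ℂ) • (1 : Matrix (Fin k) (Fin k) ℂ)).IsHermitian := by
    simp [IsHermitian, hΛ.isHermitian.eq]
  rw [hherm.posSemidef_iff_eigenvalues_nonneg]
  intro i
  set μ := hherm.eigenvalues i
  set v := hherm.eigenvectorBasis i
  have hv : v ≠ 0 := hherm.eigenvectorBasis.orthonormal.ne_zero i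
  have h1 : Λ *ᵥ v.ofLp = ((μ + σ : ℝ) : ℂ) • v.ofLp := by
    have := hherm.mulVec_eigenvectorBasis i
    rw [Matrix.sub_mulVec, sub_eq_iff_eq_add, Matrix.smul_mulVec, Matrix.one_mulVec] at this
    rw [this]
    push_cast
    rw [add_smul]
    rfl
  -- The sign is needed because `h4` below compares squares only.
  have hnn : 0 ≤ μ + σ := by
    have h2 := hΛ.re_dotProduct_nonneg v.ofLp
    have h3 : 0 < RCLike.re (star v.ofLp ⬝ᵥ v.ofLp) := by
      have : 0 < star v.ofLp ⬝ᵥ v.ofLp := by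
        rw [dotProduct_star_self_pos_iff]
        exact fun h => hv (by ext i; simp [h])
      exact (Complex.lt_def.mp this).1
    rw [h1, dotProduct_smul, smul_eq_mul, RCLike.re_to_complex, Complex.re_ofReal_mul] at h2
    exact nonneg_of_mul_nonneg_left h2 h3
  have h4 : sigmaMin (W * Λ) ^ 2 ≤ (μ + σ) ^ 2 := by
    refine sigmaMin_sq_le_of_mulVec_eq hk hkn hv ?_
    rw [conjTranspose_mul, Matrix.mul_assoc, ← Matrix.mul_assoc Wᴴ, show Wᴴ * W = 1 from hW,
      Matrix.one_mul, hΛ.isHermitian.eq, ← Matrix.mulVec_mulVec, h1, Matrix.mulVec_smul, h1,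
      smul_smul]
    push_cast
    rw [sq]
  have h5 := abs_le_of_sq_le_sq h4 hnn
  have : σ ≤ μ + σ := (le_abs_self _).trans h5
  show 0 ≤ μ
  linarith

lemma sigmaMin_mul_frobNorm_sub_sq_le {W U H : Matrix (Fin n) (Fin k) ℂ} (hk : 1 ≤ k)
    (hkn : k ≤ n) (hW : IsOrthonormalPolarFactor W H) (hU : U ∈ stiefel n k) :
    sigmaMin H * frobNorm (W - U) ^ 2 ≤ 2 * (trace ((W - U)ᴴ * H)).re := by
  obtain ⟨hW, Λ, hΛ, rfl⟩ := hW
  have h := ((posSemidef_sub_sigmaMin hk hkn hW hΛ).mul_mul_conjTranspose_same (W - U)).trace_nonneg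
  have h' := (Complex.le_def.mp h).1
  rw [two_mul_re_trace_polar hW hU hΛ]
  rw [Matrix.mul_sub, Matrix.sub_mul, trace_sub, Matrix.mul_smul, Matrix.mul_one, Matrix.smul_mul,
    trace_smul, smul_eq_mul, Complex.sub_re, Complex.re_ofReal_mul,
    trace_mul_comm (W - U) (W - U)ᴴ, ← frobNorm_sq_eq_re_trace, Complex.zero_re] at h'
  linarith

/-- The projection `1 - U Uᴴ` kills `U Λ`, so the residual of `W Λ` is that of `(W - U) Λ`; moreover
`‖W Λ‖_F = ‖Λ‖_F`. For `H = 0` the quotient is `0` by the convention for division. -/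
lemma frobNorm_residual_div_le {W U H : Matrix (Fin n) (Fin k) ℂ}
    (hW : IsOrthonormalPolarFactor W H) (hU : U ∈ stiefel n k) :
    frobNorm (H - U * (Uᴴ * H)) ^ 2 / frobNorm H ^ 2 ≤ frobNorm (W - U) ^ 2 := by
  obtain ⟨hW, Λ, hΛ, rfl⟩ := hW
  refine div_le_of_le_mul₀ (sq_nonneg _) (sq_nonneg _) ?_
  have hU' : U * (Uᴴ * (U * Λ)) = U * Λ := by
    rw [← Matrix.mul_assoc Uᴴ, show Uᴴ * U = 1 from hU, Matrix.one_mul]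
  have h : W * Λ - U * (Uᴴ * (W * Λ)) =
      (W - U) * Λ - U * (Uᴴ * ((W - U) * Λ)) := by
    rw [Matrix.sub_mul, Matrix.mul_sub Uᴴ, Matrix.mul_sub U, hU']
    abel
  rw [h, frobNorm_mul_of_mem_stiefel hW]
  exact (frobNorm_sub_proj_le hU _).trans (frobNorm_mul_sq_le _ _)

end Matrices

/-! ### Canonical angles between column spaces. -/

section CanonicalAngles

/-- The squares of the singular values of a linear map sum up to its squared Hilbert-Schmidt norm,
computed in any orthonormal basis. -/
lemma sum_sq_singularValues {E F ι : Type*} [NormedAddCommGroup E] [InnerProductSpace ℂ E]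
    [FiniteDimensional ℂ E] [NormedAddCommGroup F] [InnerProductSpace ℂ F] [FiniteDimensional ℂ F]
    [Fintype ι] (A : E →ₗ[ℂ] F) (b : OrthonormalBasis ι ℂ E) :
    ∑ i ∈ Finset.range (Module.finrank ℂ E), A.singularValues i ^ 2 = ∑ j, ‖A (b j)‖ ^ 2 := by
  -- Both sides are the trace of `A* A`, computed once from its eigenvalues and once in the basis
  -- `b`.
  have h1 := A.isSymmetric_adjoint_comp_self.re_trace_eq_sum_eigenvalues rfl
  rw [LinearMap.trace_eq_sum_inner _ b] at h1
  rw [Finset.sum_range]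
  simp_rw [A.sq_singularValues_fin rfl]
  rw [← h1, map_sum]
  refine Finset.sum_congr rfl fun j _ => ?_
  rw [LinearMap.comp_apply, LinearMap.adjoint_inner_right, inner_self_eq_norm_sq]

/-- Needed because `sin (arccos x) ^ 2 = 1 - x ^ 2` fails for `x > 1`. -/
lemma singularValues_le_one {E F : Type*} [NormedAddCommGroup E] [InnerProductSpace ℂ E]
    [FiniteDimensional ℂ E] [NormedAddCommGroup F] [InnerProductSpace ℂ F] [FiniteDimensional ℂ F]
    (A : E →ₗ[ℂ] F) (hA : ∀ x, ‖A x‖ ≤ ‖x‖) (i : ℕ) : A.singularValues i ≤ 1 := by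
  by_cases hi : Module.finrank ℂ E ≤ i
  · rw [A.singularValues_of_finrank_le hi]
    exact zero_le_one
  obtain ⟨v, hv⟩ :=
    (A.hasEigenvalue_adjoint_comp_self_sq_singularValues (not_le.mp hi)).exists_hasEigenvector
  have h1 : ‖A v‖ ^ 2 = A.singularValues i ^ 2 * ‖v‖ ^ 2 := by
    have h2 : inner ℂ v ((LinearMap.adjoint A ∘ₗ A) v) = (‖A v‖ ^ 2 : ℂ) := by
      rw [LinearMap.comp_apply, LinearMap.adjoint_inner_right, inner_self_eq_norm_sq_to_K]
      rfl
    rw [hv.apply_eq_smul, inner_smul_right, inner_self_eq_norm_sq_to_K] at h2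
    exact Complex.ofReal_injective (by simpa using h2.symm)
  have hv0 : 0 < ‖v‖ := norm_pos_iff.mpr hv.2
  have h3 : ‖A v‖ ^ 2 ≤ 1 * ‖v‖ ^ 2 := by
    rw [one_mul]
    exact pow_le_pow_left₀ (norm_nonneg _) (hA v) 2
  rw [h1] at h3
  have h4 := le_of_mul_le_mul_right h3 (by positivity)
  exact (sq_le_one_iff₀ (A.singularValues_nonneg i)).mp h4

/-- The sum of the squared sines of the arccosines of the singular values of a contraction. -/
lemma sum_sq_sin_arccos_singularValues {E F ι : Type*} [NormedAddCommGroup E]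
    [InnerProductSpace ℂ E] [FiniteDimensional ℂ E] [NormedAddCommGroup F] [InnerProductSpace ℂ F]
    [FiniteDimensional ℂ F] [Fintype ι] (A : E →ₗ[ℂ] F) (hA : ∀ x, ‖A x‖ ≤ ‖x‖)
    (b : OrthonormalBasis ι ℂ E) :
    ∑ i ∈ Finset.range (Module.finrank ℂ E), Real.sin (Real.arccos (A.singularValues i)) ^ 2 =
      ∑ j, (1 - ‖A (b j)‖ ^ 2) := by
  have hsin : ∀ i, Real.sin (Real.arccos (A.singularValues i)) ^ 2 =
      1 - A.singularValues i ^ 2 := by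
    intro i
    rw [Real.sin_arccos, Real.sq_sqrt]
    exact sub_nonneg.mpr
      (pow_le_one₀ (A.singularValues_nonneg i) (singularValues_le_one A hA i))
  simp_rw [hsin]
  rw [Finset.sum_sub_distrib, sum_sq_singularValues A b, Finset.sum_const, Finset.card_range,
    Module.finrank_eq_card_basis b.toBasis, ← Finset.card_univ, ← Finset.sum_const,
    ← Finset.sum_sub_distrib]

variable {n k : ℕ}

/-- The squared norm of `sin Θ(S, T)` is the sum of the squared distances to `S` of the members of
an orthonormal basis of `T`. -/
lemma sinThetaNorm_sq {ι : Type*} [Fintype ι] (S T : Submodule ℂ (EuclideanSpace ℂ (Fin n)))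
    (b : OrthonormalBasis ι ℂ T) :
    sinThetaNorm S T ^ 2 =
      ∑ j, ‖(b j : EuclideanSpace ℂ (Fin n)) - S.starProjection (b j)‖ ^ 2 := by
  have h := sum_sq_sin_arccos_singularValues (E := T) (F := S)
    (S.orthogonalProjectionOnto.toLinearMap ∘ₗ T.subtype)
    (fun x => by
      rw [LinearMap.comp_apply]
      exact S.norm_orthogonalProjectionOnto_apply_le _) b
  rw [sinThetaNorm, Real.sq_sqrt (Finset.sum_nonneg fun _ _ => sq_nonneg _)]
  have h' : ∑ i ∈ Finset.range (Module.finrank ℂ T), Real.sin (canonicalAngle S T i) ^ 2 =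
      ∑ j, (1 - ‖S.starProjection (b j : EuclideanSpace ℂ (Fin n))‖ ^ 2) := by
    unfold canonicalAngle
    convert h using 2
    rw [LinearMap.comp_apply, Submodule.starProjection_apply]
    rfl
  rw [h']
  refine Finset.sum_congr rfl fun j _ => ?_
  have h1 : ‖(b j : EuclideanSpace ℂ (Fin n))‖ = 1 := b.orthonormal.1 j
  have h2 := S.norm_sq_eq_add_norm_sq_starProjection (b j : EuclideanSpace ℂ (Fin n))
  rw [h1, Submodule.starProjection_orthogonal_val] at h2
  linarith

/-- A matrix with orthonormal columns as a linear isometry. -/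
noncomputable def stiefelIsometry {U : Matrix (Fin n) (Fin k) ℂ} (hU : U ∈ stiefel n k) :
    EuclideanSpace ℂ (Fin k) →ₗᵢ[ℂ] EuclideanSpace ℂ (Fin n) :=
  (Matrix.toEuclideanLin U).isometryOfInner fun x y => by
    rw [← LinearMap.adjoint_inner_right, ← Matrix.toEuclideanLin_conjTranspose_eq_adjoint]
    congr 1
    ext i
    simp [Matrix.toLpLin_apply, Matrix.mulVec_mulVec, show Uᴴ * U = 1 from hU]

/-- A matrix with orthonormal columns as an isometry onto its column space. -/
noncomputable def colIsometryEquiv {U : Matrix (Fin n) (Fin k) ℂ} (hU : U ∈ stiefel n k) :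
    EuclideanSpace ℂ (Fin k) ≃ₗᵢ[ℂ] colSpace U :=
  (stiefelIsometry hU).equivRange

/-- The columns of a matrix in the Stiefel manifold as an orthonormal basis of its column space. -/
noncomputable def colBasis {U : Matrix (Fin n) (Fin k) ℂ} (hU : U ∈ stiefel n k) :
    OrthonormalBasis (Fin k) ℂ (colSpace U) :=
  (EuclideanSpace.basisFun (Fin k) ℂ).map (colIsometryEquiv hU)

lemma colBasis_apply {U : Matrix (Fin n) (Fin k) ℂ} (hU : U ∈ stiefel n k) (j : Fin k) :
    (colBasis hU j : EuclideanSpace ℂ (Fin n)) =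
      Matrix.toEuclideanLin U (EuclideanSpace.single j 1) := by
  rw [colBasis, OrthonormalBasis.map_apply, EuclideanSpace.basisFun_apply]
  rfl

/-- The distance from the `j`-th column of `U` to the column space of `W` is at most its distance to
the `j`-th column of `W`. -/
lemma sinThetaNorm_colSpace_sq_le (W : Matrix (Fin n) (Fin k) ℂ) {U : Matrix (Fin n) (Fin k) ℂ}
    (hU : U ∈ stiefel n k) :
    sinThetaNorm (colSpace W) (colSpace U) ^ 2 ≤ frobNorm (W - U) ^ 2 := by
  rw [sinThetaNorm_sq _ _ (colBasis hU), frobNorm_sq, Finset.sum_comm]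
  refine Finset.sum_le_sum fun j _ => ?_
  set w : EuclideanSpace ℂ (Fin n) := Matrix.toEuclideanLin W (EuclideanSpace.single j 1) with hw
  have hwS : w ∈ colSpace W := LinearMap.mem_range_self _ _
  set u : EuclideanSpace ℂ (Fin n) := ((colBasis hU j : colSpace U) : EuclideanSpace ℂ (Fin n)) with hu
  have h1 : ‖u - (colSpace W).starProjection u‖ ≤ ‖u - w‖ := by
    rw [Submodule.starProjection_minimal]
    exact ciInf_le ⟨0, by rintro _ ⟨x, rfl⟩; exact norm_nonneg _⟩ (⟨w, hwS⟩ : colSpace W)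
  refine (pow_le_pow_left₀ (norm_nonneg _) h1 2).trans (le_of_eq ?_)
  rw [norm_sub_rev, EuclideanSpace.norm_sq_eq]
  refine Finset.sum_congr rfl fun i _ => ?_
  rw [hu, colBasis_apply, hw]
  simp [Matrix.toLpLin_apply]

end CanonicalAngles

/-! ### Compactness of the Stiefel manifold and limits of polar factors. -/

section Stiefel

variable {n k : ℕ}

lemma isClosed_stiefel : IsClosed (stiefel n k) :=
  isClosed_eq (by fun_prop) continuous_const

lemma isCompact_stiefel : IsCompact (stiefel n k) := by
  have hK : IsCompact (Set.univ.pi fun _ : Fin n => Set.univ.pi fun _ : Fin k =>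
      Metric.closedBall (0 : ℂ) (Real.sqrt k)) :=
    isCompact_univ_pi fun _ => isCompact_univ_pi fun _ => isCompact_closedBall _ _
  refine IsCompact.of_isClosed_subset (X := Matrix (Fin n) (Fin k) ℂ) hK isClosed_stiefel ?_
  intro U hU i _ j _
  rw [mem_closedBall_zero_iff]
  refine Real.le_sqrt_of_sq_le ?_
  rw [← frobNorm_sq_of_mem_stiefel hU, frobNorm_sq]
  refine (Finset.single_le_sum (f := fun j => ‖U i j‖ ^ 2) (fun _ _ => sq_nonneg _)
    (Finset.mem_univ j)).trans ?_
  exact Finset.single_le_sum (f := fun i => ∑ j, ‖U i j‖ ^ 2)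
    (fun _ _ => Finset.sum_nonneg fun _ _ => sq_nonneg _) (Finset.mem_univ i)

lemma isClosed_posSemidef : IsClosed {A : Matrix (Fin k) (Fin k) ℂ | A.PosSemidef} := by
  simp only [posSemidef_iff_dotProduct_mulVec, IsHermitian, Set.ofPred_and, Set.ofPred_forall]
  refine (isClosed_eq (by fun_prop) (by fun_prop)).inter (isClosed_iInter fun x => ?_)
  exact isClosed_le continuous_const
    (continuous_const.dotProduct (continuous_id.matrix_mulVec continuous_const))

lemma IsOrthonormalPolarFactor.polarKKT {W H : Matrix (Fin n) (Fin k) ℂ}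
    (h : IsOrthonormalPolarFactor W H) : PolarKKT W H := by
  obtain ⟨hW, Λ, hΛ, rfl⟩ := h
  have : Wᴴ * (W * Λ) = Λ := by
    rw [← Matrix.mul_assoc, show Wᴴ * W = 1 from hW, Matrix.one_mul]
  exact ⟨hW, by rw [this], by rwa [this]⟩

lemma PolarKKT.isOrthonormalPolarFactor {W H : Matrix (Fin n) (Fin k) ℂ}
    (h : PolarKKT W H) : IsOrthonormalPolarFactor W H :=
  ⟨h.1, _, h.2.2, h.2.1⟩

/-- Writing `Λ` as `Wᴴ H` removes the existential quantifier, so being a polar factor becomes a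
closed condition and passes to limits. -/
lemma isClosed_polarKKT :
    IsClosed {p : Matrix (Fin n) (Fin k) ℂ × Matrix (Fin n) (Fin k) ℂ | PolarKKT p.1 p.2} := by
  simp only [PolarKKT, Set.ofPred_and]
  refine (isClosed_stiefel.preimage continuous_fst).inter (IsClosed.inter ?_ ?_)
  · exact isClosed_eq (by fun_prop) (by fun_prop)
  · exact isClosed_posSemidef.preimage
      (f := fun p : Matrix (Fin n) (Fin k) ℂ × Matrix (Fin n) (Fin k) ℂ => p.1ᴴ * p.2)
      (by fun_prop)

/-- Two elements of the Stiefel manifold at which `X ↦ Re tr (Xᴴ H)` takes the same value are polar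
factors of `H` simultaneously, and coincide if `H` has full column rank. -/
lemma polarKKT_of_re_trace_eq_zero {W U H : Matrix (Fin n) (Fin k) ℂ} (hW : PolarKKT W H)
    (hU : U ∈ stiefel n k) (h : (trace ((W - U)ᴴ * H)).re = 0) :
    PolarKKT U H ∧ (H.rank = k → W = U) := by
  obtain ⟨hW', Λ, hΛ, rfl⟩ := hW.isOrthonormalPolarFactor
  have h0 : (W - U) * Λ = 0 := mul_eq_zero_of_re_trace_eq_zero hΛ _ (by
    rw [← two_mul_re_trace_polar hW' hU hΛ, h, mul_zero])
  have h1 : W * Λ = U * Λ := by rwa [Matrix.sub_mul, sub_eq_zero] at h0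
  refine ⟨IsOrthonormalPolarFactor.polarKKT ⟨hU, Λ, hΛ, h1⟩, fun hr => ?_⟩
  -- `k = rank (W Λ) ≤ rank Λ ≤ k`, so `Λ` is invertible and can be cancelled from `(W - U) Λ = 0`.
  have hrank : Λ.rank = k := le_antisymm ((rank_le_card_width Λ).trans (by simp))
    (hr.symm.le.trans (rank_mul_le_right W Λ))
  have hunit : IsUnit Λ := by
    rw [← Matrix.mulVec_surjective_iff_isUnit]
    have : LinearMap.range Λ.mulVecLin = ⊤ := Submodule.eq_top_of_finrank_eq (by
      rw [← Matrix.rank, hrank]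
      simp)
    exact LinearMap.range_eq_top.mp this
  obtain ⟨Λ', hΛ'⟩ := hunit.exists_right_inv
  have h2 : (W - U) * Λ * Λ' = 0 := by rw [h0, Matrix.zero_mul]
  rwa [Matrix.mul_assoc, hΛ', Matrix.mul_one, sub_eq_zero] at h2

/-- Limit form of `polarKKT_of_re_trace_eq_zero`. -/
lemma polarKKT_of_tendsto {ι : Type*} {F : Filter ι} [F.NeBot]
    {W U H : ι → Matrix (Fin n) (Fin k) ℂ} {Ws Us Hs : Matrix (Fin n) (Fin k) ℂ}
    (hpol : ∀ j, IsOrthonormalPolarFactor (W j) (H j)) (hU : ∀ j, U j ∈ stiefel n k)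
    (hWs : Tendsto W F (𝓝 Ws)) (hUs : Tendsto U F (𝓝 Us)) (hHs : Tendsto H F (𝓝 Hs))
    (hgap : Tendsto (fun j => (trace ((W j - U j)ᴴ * H j)).re) F (𝓝 0)) :
    PolarKKT Us Hs ∧ (Hs.rank = k → Ws = Us) := by
  have hW : PolarKKT Ws Hs := isClosed_polarKKT.mem_of_tendsto (hWs.prodMk_nhds hHs)
    (Eventually.of_forall fun j => (hpol j).polarKKT)
  refine polarKKT_of_re_trace_eq_zero hW
    (isClosed_stiefel.mem_of_tendsto hUs (Eventually.of_forall hU)) ?_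
  have hc : Continuous fun p : (Matrix (Fin n) (Fin k) ℂ × Matrix (Fin n) (Fin k) ℂ) ×
      Matrix (Fin n) (Fin k) ℂ => (trace ((p.1.1 - p.1.2)ᴴ * p.2)).re := by fun_prop
  exact tendsto_nhds_unique
    ((hc.tendsto ((Ws, Us), Hs)).comp ((hWs.prodMk_nhds hUs).prodMk_nhds hHs)) hgap

end Stiefel

/-! ### Convergence to an isolated accumulation point. -/

/-- A sequence in a compact set converges to an isolated accumulation point `p` if the shifted
sequence tends to `p` along every ultrafilter along which the sequence does. -/
lemma tendsto_of_isIsolatedAccPt {X : Type*} [TopologicalSpace X] [RegularSpace X] {K : Set X}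
    (hK : IsCompact K) {s : ℕ → X} (hs : ∀ j, s j ∈ K) {p : X} (hp : IsIsolatedAccPt s p)
    (hstep : ∀ F : Ultrafilter ℕ, (F : Filter ℕ) ≤ atTop → Tendsto s F (𝓝 p) →
      Tendsto (fun j => s (j + 1)) F (𝓝 p)) :
    Tendsto s atTop (𝓝 p) := by
  obtain ⟨hcl, hiso⟩ := hp
  rw [eventually_nhdsWithin_iff] at hiso
  rw [(closed_nhds_basis p).tendsto_right_iff]
  rintro D ⟨hD, -⟩
  obtain ⟨C, ⟨hC, hCc⟩, hCD⟩ := (closed_nhds_basis p).mem_iff.mp (inter_mem hD hiso)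
  -- `C` is a closed neighbourhood whose only accumulation point of `s` is `p`. Were it left
  -- infinitely often, an ultrafilter on the exit times would have a limit in `C`, hence `p`; then
  -- `s (j + 1)` would tend to `p` as well, yet stay outside `C`.
  have hinv : ∀ᶠ j in atTop, s j ∈ C → s (j + 1) ∈ C := by
    by_contra hcon
    rw [not_eventually] at hcon
    have hne : (atTop ⊓ 𝓟 {j | ¬(s j ∈ C → s (j + 1) ∈ C)}).NeBot :=
      frequently_mem_iff_neBot.mp hcon
    set F := Ultrafilter.of (atTop ⊓ 𝓟 {j | ¬(s j ∈ C → s (j + 1) ∈ C)})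
    have hF := Ultrafilter.of_le (atTop ⊓ 𝓟 {j | ¬(s j ∈ C → s (j + 1) ∈ C)})
    have hFt : (F : Filter ℕ) ≤ atTop := hF.trans inf_le_left
    have hFm : ∀ᶠ j in (F : Filter ℕ), s j ∈ C ∧ s (j + 1) ∉ C := by
      filter_upwards [le_principal_iff.mp (hF.trans inf_le_right)] with j hj
      exact Classical.not_imp.mp hj
    obtain ⟨q, -, hq⟩ := hK.ultrafilter_le_nhds (F.map s)
      (le_principal_iff.mpr (Filter.mem_map.mpr (univ_mem' hs)))
    have hqs : Tendsto s F (𝓝 q) := hq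
    have hqC : q ∈ C := hCc.mem_of_tendsto hqs (hFm.mono fun _ h => h.1)
    have hqp : q = p := by
      by_contra hne'
      exact (hCD hqC).2 hne' (mapClusterPt_iff_ultrafilter.mpr ⟨F, hFt, hqs⟩)
    subst hqp
    obtain ⟨j, hj1, hj2⟩ := ((hstep F hFt hqs).eventually hC |>.and hFm).exists
    exact hj2.2 hj1
  obtain ⟨J, hJ⟩ := eventually_atTop.mp hinv
  -- The sequence visits `C` after time `J`, and from then on it stays there.
  obtain ⟨j₀, hj₀, hj₀C⟩ := (frequently_atTop.mp (hcl.frequently hC)) J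
  filter_upwards [eventually_ge_atTop j₀] with j hj
  suffices s j ∈ C from (hCD this).1
  induction j, hj using Nat.le_induction with
  | base => exact hj₀C
  | succ j hj ih => exact hJ j (hj₀.trans hj) ih

/-! ### Gains of the alternating iteration and its accumulation points. -/

section Iteration

variable {n₁ n₂ k N : ℕ} {τ : Composition k} {B : Fin N → Matrix (Fin n₁) (Fin n₂) ℂ}

lemma gradV_eq_gradU_conjTranspose (U : Matrix (Fin n₁) (Fin k) ℂ) (V : Matrix (Fin n₂) (Fin k) ℂ) :
    gradV τ B U V = gradU τ (fun l => (B l)ᴴ) V U := by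
  simp [gradU, gradV]

lemma objective_nonneg (U : Matrix (Fin n₁) (Fin k) ℂ) (V : Matrix (Fin n₂) (Fin k) ℂ) :
    0 ≤ objective τ B U V :=
  Finset.sum_nonneg fun _ _ => sq_nonneg _

/-- The objective is convex in `U`, so it lies above its linearization. -/
lemma objective_add_re_trace_gradU_le (W U : Matrix (Fin n₁) (Fin k) ℂ)
    (V : Matrix (Fin n₂) (Fin k) ℂ) :
    objective τ B U V + (trace ((W - U)ᴴ * gradU τ B U V)).re ≤ objective τ B W V := by
  have h := objective_add_left τ B U (W - U) V
  rw [add_sub_cancel] at h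
  linarith [objective_nonneg (τ := τ) (B := B) (W - U) V]

lemma objective_add_re_trace_gradV_le (U : Matrix (Fin n₁) (Fin k) ℂ)
    (W V : Matrix (Fin n₂) (Fin k) ℂ) :
    objective τ B U V + (trace ((W - V)ᴴ * gradV τ B U V)).re ≤ objective τ B U W := by
  rw [objective_swap, objective_swap τ B U W, gradV_eq_gradU_conjTranspose]
  exact objective_add_re_trace_gradU_le W V U

lemma objective_le {U : Matrix (Fin n₁) (Fin k) ℂ} {V : Matrix (Fin n₂) (Fin k) ℂ}
    (hU : U ∈ stiefel n₁ k) (hV : V ∈ stiefel n₂ k) :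
    objective τ B U V ≤ ∑ l, (k : ℝ) * frobNorm (B l) ^ 2 * k := by
  refine Finset.sum_le_sum fun l _ => (frobNorm_blockDiagPart_sq_le _ _).trans ?_
  refine (frobNorm_mul_sq_le _ _).trans ?_
  rw [frobNorm_sq_of_mem_stiefel hV]
  refine mul_le_mul_of_nonneg_right ((frobNorm_mul_sq_le _ _).trans ?_) (Nat.cast_nonneg k)
  rw [frobNorm_conjTranspose, frobNorm_sq_of_mem_stiefel hU]

lemma continuous_blockDiagPart : Continuous (blockDiagPart τ) := by
  refine continuous_matrix fun i j => ?_
  by_cases h : τ.index i = τ.index j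
  · simpa [blockDiagPart, h] using continuous_id.matrix_elem i j
  · simpa [blockDiagPart, h] using continuous_const

lemma continuous_gradU : Continuous fun p : Matrix (Fin n₁) (Fin k) ℂ × Matrix (Fin n₂) (Fin k) ℂ =>
    gradU τ B p.1 p.2 := by
  unfold gradU
  have h := continuous_blockDiagPart (τ := τ)
  fun_prop

lemma continuous_gradV : Continuous fun p : Matrix (Fin n₁) (Fin k) ℂ × Matrix (Fin n₂) (Fin k) ℂ =>
    gradV τ B p.1 p.2 := by
  unfold gradV
  have h := continuous_blockDiagPart (τ := τ)
  fun_prop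

namespace IsGaussSeidelASCF

variable {U : ℕ → Matrix (Fin n₁) (Fin k) ℂ} {V : ℕ → Matrix (Fin n₂) (Fin k) ℂ}

lemma U_mem (h : IsGaussSeidelASCF τ B U V) : ∀ j, U j ∈ stiefel n₁ k
  | 0 => h.init_U
  | j + 1 => (h.step_U j).1

lemma V_mem (h : IsGaussSeidelASCF τ B U V) : ∀ j, V j ∈ stiefel n₂ k
  | 0 => h.init_V
  | j + 1 => (h.step_V j).1

lemma gainU_nonneg (h : IsGaussSeidelASCF τ B U V) (j : ℕ) :
    0 ≤ (trace ((U (j + 1) - U j)ᴴ * gradU τ B (U j) (V j))).re :=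
  re_trace_polar_nonneg (h.step_U j) (h.U_mem j)

lemma gainV_nonneg (h : IsGaussSeidelASCF τ B U V) (j : ℕ) :
    0 ≤ (trace ((V (j + 1) - V j)ᴴ * gradV τ B (U (j + 1)) (V j))).re :=
  re_trace_polar_nonneg (h.step_V j) (h.V_mem j)

/-- One step of the iteration increases the objective by at least the two linear gains. -/
lemma objective_add_gain_le (τ : Composition k) (B : Fin N → Matrix (Fin n₁) (Fin n₂) ℂ)
    (U : ℕ → Matrix (Fin n₁) (Fin k) ℂ) (V : ℕ → Matrix (Fin n₂) (Fin k) ℂ) (j : ℕ) :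
    objective τ B (U j) (V j) + (trace ((U (j + 1) - U j)ᴴ * gradU τ B (U j) (V j))).re +
        (trace ((V (j + 1) - V j)ᴴ * gradV τ B (U (j + 1)) (V j))).re ≤
      objective τ B (U (j + 1)) (V (j + 1)) := by
  have h1 := objective_add_re_trace_gradU_le (τ := τ) (B := B) (U (j + 1)) (U j) (V j)
  have h2 := objective_add_re_trace_gradV_le (τ := τ) (B := B) (U (j + 1)) (V (j + 1)) (V j)
  linarith

lemma monotone_objective (h : IsGaussSeidelASCF τ B U V) :
    Monotone fun j => objective τ B (U j) (V j) :=
  monotone_nat_of_le_succ fun j => by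
    linarith [objective_add_gain_le τ B U V j, h.gainU_nonneg j, h.gainV_nonneg j]

lemma exists_tendsto_objective (h : IsGaussSeidelASCF τ B U V) :
    ∃ L : ℝ, Tendsto (fun j => objective τ B (U j) (V j)) atTop (𝓝 L) :=
  ⟨_, tendsto_atTop_ciSup h.monotone_objective
    ⟨_, by rintro _ ⟨j, rfl⟩; exact objective_le (h.U_mem j) (h.V_mem j)⟩⟩

/-- The differences telescope, and the objective stays between `0` and the constant of
`objective_le`. -/
lemma summable_of_le_objective_sub (h : IsGaussSeidelASCF τ B U V) {g : ℕ → ℝ}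
    (hg : ∀ j, 0 ≤ g j)
    (hle : ∀ j, g j ≤ objective τ B (U (j + 1)) (V (j + 1)) - objective τ B (U j) (V j)) :
    Summable g := by
  refine summable_of_sum_range_le (c := ∑ l, (k : ℝ) * frobNorm (B l) ^ 2 * k) hg fun m => ?_
  refine (Finset.sum_le_sum fun j _ => hle j).trans ?_
  rw [Finset.sum_range_sub fun j => objective τ B (U j) (V j)]
  linarith [objective_le (τ := τ) (B := B) (h.U_mem m) (h.V_mem m),
    objective_nonneg (τ := τ) (B := B) (U 0) (V 0)]

lemma summable_gainU (h : IsGaussSeidelASCF τ B U V) :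
    Summable fun j => (trace ((U (j + 1) - U j)ᴴ * gradU τ B (U j) (V j))).re :=
  h.summable_of_le_objective_sub h.gainU_nonneg fun j => by
    linarith [objective_add_gain_le τ B U V j, h.gainV_nonneg j]

lemma summable_gainV (h : IsGaussSeidelASCF τ B U V) :
    Summable fun j => (trace ((V (j + 1) - V j)ᴴ * gradV τ B (U (j + 1)) (V j))).re :=
  h.summable_of_le_objective_sub h.gainV_nonneg fun j => by
    linarith [objective_add_gain_le τ B U V j, h.gainU_nonneg j]

/-- Stated for a general `g` so that it serves both the angle series and the residual series. -/
lemma summable_sigmaMin_gradU_mul (h : IsGaussSeidelASCF τ B U V) (hk : 1 ≤ k) (hkn : k ≤ n₁)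
    {g : ℕ → ℝ} (hg : ∀ j, 0 ≤ g j) (hle : ∀ j, g j ≤ frobNorm (U (j + 1) - U j) ^ 2) :
    Summable fun j => sigmaMin (gradU τ B (U j) (V j)) * g j :=
  Summable.of_nonneg_of_le (fun j => mul_nonneg (sigmaMin_nonneg _) (hg j))
    (fun j => (mul_le_mul_of_nonneg_left (hle j) (sigmaMin_nonneg _)).trans
      (sigmaMin_mul_frobNorm_sub_sq_le hk hkn (h.step_U j) (h.U_mem j)))
    (h.summable_gainU.mul_left 2)

lemma summable_sigmaMin_gradV_mul (h : IsGaussSeidelASCF τ B U V) (hk : 1 ≤ k) (hkn : k ≤ n₂)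
    {g : ℕ → ℝ} (hg : ∀ j, 0 ≤ g j) (hle : ∀ j, g j ≤ frobNorm (V (j + 1) - V j) ^ 2) :
    Summable fun j => sigmaMin (gradV τ B (U (j + 1)) (V j)) * g j :=
  Summable.of_nonneg_of_le (fun j => mul_nonneg (sigmaMin_nonneg _) (hg j))
    (fun j => (mul_le_mul_of_nonneg_left (hle j) (sigmaMin_nonneg _)).trans
      (sigmaMin_mul_frobNorm_sub_sq_le hk hkn (h.step_V j) (h.V_mem j)))
    (h.summable_gainV.mul_left 2)

/-- Along an ultrafilter compactness gives a limit at once, which replaces the extraction of further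
subsequences. -/
lemma exists_tendsto_U_succ (h : IsGaussSeidelASCF τ B U V) (F : Ultrafilter ℕ) (φ : ℕ → ℕ) :
    ∃ Uh, Tendsto (fun i => U (φ i + 1)) F (𝓝 Uh) := by
  obtain ⟨Uh, -, hUh⟩ := isCompact_stiefel.ultrafilter_le_nhds (F.map fun i => U (φ i + 1))
    (le_principal_iff.mpr (Filter.mem_map.mpr (univ_mem' fun i => h.U_mem (φ i + 1))))
  exact ⟨Uh, hUh⟩

lemma exists_tendsto_V_succ (h : IsGaussSeidelASCF τ B U V) (F : Ultrafilter ℕ) (φ : ℕ → ℕ) :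
    ∃ Vh, Tendsto (fun i => V (φ i + 1)) F (𝓝 Vh) := by
  obtain ⟨Vh, -, hVh⟩ := isCompact_stiefel.ultrafilter_le_nhds (F.map fun i => V (φ i + 1))
    (le_principal_iff.mpr (Filter.mem_map.mpr (univ_mem' fun i => h.V_mem (φ i + 1))))
  exact ⟨Vh, hVh⟩

/-- The limit of the `U` update along a filter. -/
lemma polarKKT_gradU_of_tendsto (h : IsGaussSeidelASCF τ B U V) {F : Filter ℕ} [F.NeBot]
    {φ : ℕ → ℕ} (hφ : Tendsto φ F atTop) {Us Uh : Matrix (Fin n₁) (Fin k) ℂ}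
    {Vs : Matrix (Fin n₂) (Fin k) ℂ}
    (hUV : Tendsto (fun i => (U (φ i), V (φ i))) F (𝓝 (Us, Vs)))
    (hUh : Tendsto (fun i => U (φ i + 1)) F (𝓝 Uh)) :
    PolarKKT Us (gradU τ B Us Vs) ∧ ((gradU τ B Us Vs).rank = k → Uh = Us) := by
  have hH : Tendsto (fun i => gradU τ B (U (φ i)) (V (φ i))) F (𝓝 (gradU τ B Us Vs)) := by
    have hc := ((continuous_gradU (τ := τ) (B := B)).tendsto (Us, Vs)).comp hUV
    exact hc
  have hgap := h.summable_gainU.tendsto_atTop_zero.comp hφ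
  exact polarKKT_of_tendsto (W := fun i => U (φ i + 1)) (U := fun i => U (φ i))
    (fun i => h.step_U (φ i)) (fun i => h.U_mem (φ i)) hUh hUV.fst_nhds hH hgap

/-- The limit of the `V` update along a filter. -/
lemma polarKKT_gradV_of_tendsto (h : IsGaussSeidelASCF τ B U V) {F : Filter ℕ} [F.NeBot]
    {φ : ℕ → ℕ} (hφ : Tendsto φ F atTop) {Uh : Matrix (Fin n₁) (Fin k) ℂ}
    {Vs Vh : Matrix (Fin n₂) (Fin k) ℂ} (hVs : Tendsto (fun i => V (φ i)) F (𝓝 Vs))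
    (hUh : Tendsto (fun i => U (φ i + 1)) F (𝓝 Uh))
    (hVh : Tendsto (fun i => V (φ i + 1)) F (𝓝 Vh)) :
    PolarKKT Vs (gradV τ B Uh Vs) ∧ ((gradV τ B Uh Vs).rank = k → Vh = Vs) := by
  have hH : Tendsto (fun i => gradV τ B (U (φ i + 1)) (V (φ i))) F (𝓝 (gradV τ B Uh Vs)) := by
    have hc := ((continuous_gradV (τ := τ) (B := B)).tendsto (Uh, Vs)).comp (hUh.prodMk_nhds hVs)
    exact hc
  have hgap := h.summable_gainV.tendsto_atTop_zero.comp hφ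
  exact polarKKT_of_tendsto (W := fun i => V (φ i + 1)) (U := fun i => V (φ i))
    (fun i => h.step_V (φ i)) (fun i => h.V_mem (φ i)) hVh hVs hH hgap

variable {Us : Matrix (Fin n₁) (Fin k) ℂ} {Vs : Matrix (Fin n₂) (Fin k) ℂ} {φ : ℕ → ℕ}

lemma exists_mapClusterPt_U_succ (h : IsGaussSeidelASCF τ B U V) (φ : ℕ → ℕ) :
    ∃ Uh, MapClusterPt Uh atTop fun i => U (φ i + 1) := by
  obtain ⟨Uh, hUh⟩ := h.exists_tendsto_U_succ (Ultrafilter.of atTop) φ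
  exact ⟨Uh, mapClusterPt_iff_ultrafilter.mpr ⟨_, Ultrafilter.of_le atTop, hUh⟩⟩

lemma polarKKT_gradU (h : IsGaussSeidelASCF τ B U V) (hφ : StrictMono φ)
    (hUV : Tendsto (fun i => (U (φ i), V (φ i))) atTop (𝓝 (Us, Vs))) :
    PolarKKT Us (gradU τ B Us Vs) := by
  have hF := Ultrafilter.of_le (atTop : Filter ℕ)
  obtain ⟨Uh, hUh⟩ := h.exists_tendsto_U_succ (Ultrafilter.of atTop) φ
  exact (h.polarKKT_gradU_of_tendsto (hφ.tendsto_atTop.mono_left hF) (hUV.mono_left hF) hUh).1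

lemma polarKKT_gradV (h : IsGaussSeidelASCF τ B U V) (hφ : StrictMono φ)
    (hUV : Tendsto (fun i => (U (φ i), V (φ i))) atTop (𝓝 (Us, Vs)))
    {Uh : Matrix (Fin n₁) (Fin k) ℂ} (hUh : MapClusterPt Uh atTop fun i => U (φ i + 1)) :
    PolarKKT Vs (gradV τ B Uh Vs) := by
  obtain ⟨F, hF, hUh⟩ := mapClusterPt_iff_ultrafilter.mp hUh
  obtain ⟨Vh, hVh⟩ := h.exists_tendsto_V_succ F φ
  exact (h.polarKKT_gradV_of_tendsto (hφ.tendsto_atTop.mono_left hF)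
    (hUV.snd_nhds.mono_left hF) hUh hVh).1

lemma eq_of_mapClusterPt_U_succ (h : IsGaussSeidelASCF τ B U V) (hφ : StrictMono φ)
    (hUV : Tendsto (fun i => (U (φ i), V (φ i))) atTop (𝓝 (Us, Vs)))
    (hr : (gradU τ B Us Vs).rank = k)
    {Uh : Matrix (Fin n₁) (Fin k) ℂ} (hUh : MapClusterPt Uh atTop fun i => U (φ i + 1)) :
    Uh = Us := by
  obtain ⟨F, hF, hUh⟩ := mapClusterPt_iff_ultrafilter.mp hUh
  exact (h.polarKKT_gradU_of_tendsto (hφ.tendsto_atTop.mono_left hF) (hUV.mono_left hF) hUh).2 hr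

lemma tendsto_of_isIsolatedAccPt (h : IsGaussSeidelASCF τ B U V)
    (hiso : IsIsolatedAccPt (fun j => (U j, V j)) (Us, Vs))
    (hr₁ : (gradU τ B Us Vs).rank = k) (hr₂ : (gradV τ B Us Vs).rank = k) :
    Tendsto (fun j => (U j, V j)) atTop (𝓝 (Us, Vs)) := by
  have hK : IsCompact (stiefel n₁ k ×ˢ stiefel n₂ k) := isCompact_stiefel.prod isCompact_stiefel
  have hmem : ∀ j, (U j, V j) ∈ stiefel n₁ k ×ˢ stiefel n₂ k :=
    fun j => Set.mk_mem_prod (h.U_mem j) (h.V_mem j)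
  refine JointSVD.tendsto_of_isIsolatedAccPt hK hmem hiso fun F hF hUV => ?_
  obtain ⟨Uh, hUh⟩ := h.exists_tendsto_U_succ F id
  obtain ⟨Vh, hVh⟩ := h.exists_tendsto_V_succ F id
  have hid : Tendsto id (F : Filter ℕ) atTop := hF
  -- The order matters: only once `Uh = Us` is known does the rank hypothesis on `gradV` at `(Us,
  -- Vs)` apply to the `V` update, which uses the new `U`.
  have hU : Uh = Us := (h.polarKKT_gradU_of_tendsto hid hUV hUh).2 hr₁
  subst hU
  have hV : Vh = Vs := (h.polarKKT_gradV_of_tendsto hid hUV.snd_nhds hUh hVh).2 hr₂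
  subst hV
  exact hUh.prodMk_nhds hVh

end IsGaussSeidelASCF

end Iteration

end JointSVD

open JointSVD in
theorem mainTheorem1 {n₁ n₂ k N : ℕ} (hk : 1 ≤ k) (hkn : k ≤ min n₁ n₂)
    (τ : Composition k) (B : Fin N → Matrix (Fin n₁) (Fin n₂) ℂ)
    (U : ℕ → Matrix (Fin n₁) (Fin k) ℂ) (V : ℕ → Matrix (Fin n₂) (Fin k) ℂ)
    (hUV : IsGaussSeidelASCF τ B U V) :
    -- (a)
    (Monotone (fun j => objective τ B (U j) (V j)) ∧
      ∃ L : ℝ, Tendsto (fun j => objective τ B (U j) (V j)) atTop (𝓝 L)) ∧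
    -- (b)
    (∀ (Us : Matrix (Fin n₁) (Fin k) ℂ) (Vs : Matrix (Fin n₂) (Fin k) ℂ) (φ : ℕ → ℕ),
      StrictMono φ → Tendsto (fun i => (U (φ i), V (φ i))) atTop (𝓝 (Us, Vs)) →
      PolarKKT Us (gradU τ B Us Vs) ∧
      (∃ Uh, MapClusterPt Uh atTop (fun i => U (φ i + 1))) ∧
      ∀ Uh, MapClusterPt Uh atTop (fun i => U (φ i + 1)) →
        PolarKKT Vs (gradV τ B Uh Vs) ∧
        (Uh = Us → PolarKKT Us (gradU τ B Us Vs) ∧ PolarKKT Vs (gradV τ B Us Vs))) ∧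
    -- (c)
    (∀ (Us : Matrix (Fin n₁) (Fin k) ℂ) (Vs : Matrix (Fin n₂) (Fin k) ℂ) (φ : ℕ → ℕ),
      StrictMono φ → Tendsto (fun i => (U (φ i), V (φ i))) atTop (𝓝 (Us, Vs)) →
      (gradU τ B Us Vs).rank = k →
      (∀ Uh, MapClusterPt Uh atTop (fun i => U (φ i + 1)) → Uh = Us) ∧
      PolarKKT Us (gradU τ B Us Vs) ∧ PolarKKT Vs (gradV τ B Us Vs)) ∧
    -- (d)
    (∀ (Us : Matrix (Fin n₁) (Fin k) ℂ) (Vs : Matrix (Fin n₂) (Fin k) ℂ),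
      IsIsolatedAccPt (fun j => (U j, V j)) (Us, Vs) →
      (gradU τ B Us Vs).rank = k → (gradV τ B Us Vs).rank = k →
      Tendsto (fun j => (U j, V j)) atTop (𝓝 (Us, Vs))) ∧
    -- (e)
    (Summable (fun j => sigmaMin (gradU τ B (U j) (V j)) *
        sinThetaNorm (colSpace (U (j + 1))) (colSpace (U j)) ^ 2) ∧
      Summable (fun j => sigmaMin (gradV τ B (U (j + 1)) (V j)) *
        sinThetaNorm (colSpace (V (j + 1))) (colSpace (V j)) ^ 2) ∧
      Summable (fun j => sigmaMin (gradU τ B (U j) (V j)) *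
        (frobNorm (gradU τ B (U j) (V j) - U j * ((U j)ᴴ * gradU τ B (U j) (V j))) ^ 2 /
          frobNorm (gradU τ B (U j) (V j)) ^ 2)) ∧
      Summable (fun j => sigmaMin (gradV τ B (U (j + 1)) (V j)) *
        (frobNorm (gradV τ B (U (j + 1)) (V j) -
            V j * ((V j)ᴴ * gradV τ B (U (j + 1)) (V j))) ^ 2 /
          frobNorm (gradV τ B (U (j + 1)) (V j)) ^ 2))) := by
  have hk₁ : k ≤ n₁ := hkn.trans (min_le_left _ _)
  have hk₂ : k ≤ n₂ := hkn.trans (min_le_right _ _)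
  refine ⟨⟨hUV.monotone_objective, hUV.exists_tendsto_objective⟩, ?_, ?_, ?_, ?_, ?_, ?_, ?_⟩
  · intro Us Vs φ hφ hlim
    refine ⟨hUV.polarKKT_gradU hφ hlim, hUV.exists_mapClusterPt_U_succ φ, fun Uh hUh => ?_⟩
    refine ⟨hUV.polarKKT_gradV hφ hlim hUh, ?_⟩
    rintro rfl
    exact ⟨hUV.polarKKT_gradU hφ hlim, hUV.polarKKT_gradV hφ hlim hUh⟩
  · intro Us Vs φ hφ hlim hr
    refine ⟨fun Uh hUh => hUV.eq_of_mapClusterPt_U_succ hφ hlim hr hUh,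
      hUV.polarKKT_gradU hφ hlim, ?_⟩
    obtain ⟨Uh, hUh⟩ := hUV.exists_mapClusterPt_U_succ φ
    have hV := hUV.polarKKT_gradV hφ hlim hUh
    rwa [hUV.eq_of_mapClusterPt_U_succ hφ hlim hr hUh] at hV
  · intro Us Vs hiso hr₁ hr₂
    exact hUV.tendsto_of_isIsolatedAccPt hiso hr₁ hr₂
  · exact hUV.summable_sigmaMin_gradU_mul hk hk₁ (fun _ => sq_nonneg _)
      fun j => sinThetaNorm_colSpace_sq_le _ (hUV.U_mem j)
  · exact hUV.summable_sigmaMin_gradV_mul hk hk₂ (fun _ => sq_nonneg _)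
      fun j => sinThetaNorm_colSpace_sq_le _ (hUV.V_mem j)
  · exact hUV.summable_sigmaMin_gradU_mul hk hk₁ (fun _ => by positivity)
      fun j => frobNorm_residual_div_le (hUV.step_U j) (hUV.U_mem j)
  · exact hUV.summable_sigmaMin_gradV_mul hk hk₂ (fun _ => by positivity)
      fun j => frobNorm_residual_div_le (hUV.step_V j) (hUV.V_mem j)
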